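/- **Setting.** For every $\epsilon>0$ let a weighted rail-yard graph be given: integers $l^{(\epsilon)}<r^{(\epsilon)}$, sequences $\underline a^{(\epsilon)}\in\{L,R\}^{[l^{(\epsilon)}..r^{(\epsilon)}]}$ and $\underline b^{(\epsilon)}\in\{+,-\}^{[l^{(\epsilon)}..r^{(\epsilon)}]}$, and diagonal edge weights $x_{j,\epsilon}$. Call $j\in[l^{(\epsilon)}..r^{(\epsilon)}]$ an $(L,-)$ column if $a_j^{(\epsilon)}=L$, $b_j^{(\epsilon)}=-$. Let $N=N_{L,-}^{(\epsilon)}$ be the number of $(L,-)$ columns; their weights are positive. Let $\lambda=\lambda^{(l,\epsilon)}=(\lambda_1\ge\dots\ge\lambda_N\ge 0)$ be the left boundary partition and $\sigma_0$ a bijection from $[N]$ to the set of $(L,-)$ columns with $x_{\sigma_0(1),\epsilon}\ge\dots\ge x_{\sigma_0(N),\epsilon}$. All limits are for $\epsilon\to0^+$, and conditions at a fixed $\epsilon$ are only required for all sufficiently small $\epsilon>0$. Assume: 1. $\epsilon l^{(\epsilon)}\to l^{(0)}$ and $\epsilon r^{(\epsilon)}\to r^{(0)}$ with $l^{(0)}<r^{(0)}$.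 2. The set of weights $\{x_{\sigma_0(1),\epsilon},\dots,x_{\sigma_0(N),\epsilon}\}$ has exactly $n$ distinct elements $x_1>\dots>x_n$, with $n$ independent of $\epsilon$. 3. There are $s$ (independent of $\epsilon$), positive integers $K_1,\dots,K_s$ with $\sum_t K_t=N$, and integers $\mu_1>\dots>\mu_s\geq 0$ (the $K_t$ and $\mu_t$ may depend on $\epsilon$), such that $\lambda$ consists of $K_s$ parts $\mu_1$, followed by $K_{s-1}$ parts $\mu_2$, …, followed by $K_1$ parts $\mu_s$. 4. For $i\in[n]$ let $J_i=\{t\in[s]:\exists q\in[N],\ x_{\sigma_0(q),\epsilon}=x_i \text{ and } \lambda_q=\mu_t\}$. If $i_1<i_2$, $\ell\in J_{i_1}$ and $t\in J_{i_2}$, then $\ell<t$. 5. There are constants $C_1,C_2>0$ independent of $\epsilon$ with $C_1N\le\mu_p-\mu_q\le C_2N$ for all $1\le p<q\le s$. 6. For $i\in[s]$ let $A_i=\mu_{s-i+1}-N+\sum_{t<i}K_t$ and $B_i=A_i+K_i-1$ be the lowest and highest location of the $i$-th block of consecutive particles on the left boundary. There are fixed numbers $a_1<b_1<a_2<b_2<\dots<a_s<b_s$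 with $\sum_{i=1}^s(b_i-a_i)=1$, $A_i=a_iN+o(N)$ and $B_i=b_iN+o(N)$. 7. $x_{\sigma_0(1),\epsilon}$ is a positive constant independent of $\epsilon$, and $\liminf_{\epsilon\to0}\ \epsilon\log\min\frac{x_{i,\epsilon}}{x_{j,\epsilon}}\ \ge\ \alpha>0$, the minimum being over the $(L,-)$ columns $i,j$ with $x_{i,\epsilon}>x_{j,\epsilon}$. 8. For each $i\in[n]$ the proportion of columns of weight $x_i$ among the $(L,-)$ columns tends to some $\theta_i\in(0,1)$, where $\sum_{i\in[n]}\theta_i=1$, and $N/(r^{(\epsilon)}-l^{(\epsilon)}+1)\to\rho\in(0,1]$. **Terms.** For a bijection $\sigma$ from $[N]$ to the set of $(L,-)$ columns let $\eta_j^\sigma=|\{k\in[N]:k>j,\ x_{\sigma(k),\epsilon}\ne x_{\sigma(j),\epsilon}\}|$, and let $\phi^{(i,\sigma)}$ be the partition obtained by decreasingly ordering the numbers $\lambda_j+\eta_j^\sigma$ (with multiplicity) over all $j$ with $x_{\sigma(j),\epsilon}=x_i$. Let $\overline{\sigma}_0=\{\xi\sigma_0\}$, where $\xi$ runs over the permutations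 of the $(L,-)$ columns with $x_{\xi(j),\epsilon}=x_{j,\epsilon}$ for all $j$. Let $s_\phi=\det(h_{\phi_p-p+q})_{p,q}$ be the Schur function, taken in as many variables as $\phi$ has parts (zero parts included), and $|\phi|$ the sum of the parts of $\phi$. **Proposition 3.1.** Let $\{a_i,b_i\}_{i=1}^s$ be as in 6. There is $\alpha_0>0$, depending only on $\{a_i,b_i\}_{i=1}^s$, such that for all $l^{(0)}<r^{(0)}$ and $\rho\in(0,1]$ there is a function $C=C(\alpha)$ that is positive and strictly increasing on $[\alpha_0,\infty)$, with $\lim_{\alpha\to\infty}C(\alpha)=\infty$, and such that the following holds. For every $\alpha\ge\alpha_0$ and every family satisfying 1–8 with these parameters, for all sufficiently small $\epsilon>0$ and all $\sigma\notin\overline{\sigma}_0$, $$\left|\frac{\left(\prod_{i=1}^{n}x_{i}^{|\phi^{(i,\sigma_0)}|}\right)\left(\prod_{i=1}^{n}s_{\phi^{(i,\sigma_0)}}(1,\ldots,1)\right)}{\left(\prod_{i=1}^{n}x_{i}^{|\phi^{(i,\sigma)}|}\right)\left(\prod_{i=1}^{n}s_{\phi^{(i,\sigma)}}(1,\ldots,1)\right)}\right|\times\left|\frac{\prod_{i<j,\,x_{\sigma_0(i),\epsilon}\neq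 x_{\sigma_0(j),\epsilon}}\frac{1}{x_{\sigma_0(i),\epsilon}-x_{\sigma_0(j),\epsilon}}}{\prod_{i<j,\,x_{\sigma(i),\epsilon}\neq x_{\sigma(j),\epsilon}}\frac{1}{x_{\sigma(i),\epsilon}-x_{\sigma(j),\epsilon}}}\right|\ \ge\ e^{C(\alpha)\,\epsilon^{-2}}.$$ -/

import Mathlib

open Filter Topology

noncomputable section

namespace RailYard

/-! ### Schur functions -/

/-- The complete homogeneous symmetric polynomial `h_r` in the variables `ι`, for an integer `r`;
it is `0` for negative `r`. -/
def completeHomogeneous (ι : Type) [Fintype ι] [DecidableEq ι] (r : ℤ) : MvPolynomial ι ℝ :=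
  if 0 ≤ r then MvPolynomial.hsymm ι ℝ r.toNat else 0

/-- The Schur polynomial `s_φ = det (h_{φ_p - p + q})_{p,q}` in the variables `ι`; the partition
`φ` is given as the list of its parts (zeros allowed). -/
def schurPoly (ι : Type) [Fintype ι] [DecidableEq ι] (φ : List ℕ) : MvPolynomial ι ℝ :=
  Matrix.det (Matrix.of fun p q : Fin φ.length =>
    completeHomogeneous ι ((φ.get p : ℤ) - (p.val : ℤ) + (q.val : ℤ)))

/-- `s_φ(1, …, 1)`, where the number of variables is the length of `φ`. -/
def schurAtOnes (φ : List ℕ) : ℝ :=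
  MvPolynomial.eval (fun _ => (1 : ℝ)) (schurPoly (Fin φ.length) φ)

/-! ### Weighted rail-yard graphs with a left boundary partition -/

inductive LR : Type
  | L
  | R
  deriving DecidableEq

inductive Sgn : Type
  | plus
  | minus
  deriving DecidableEq

/-- The data of the rail-yard graph `RYG(l, r, a, b)` whose diagonal edges at abscissa `2 j` have
weight `x j`. Only the values of `a`, `b`, `x` on `[l..r]` matter. -/
structure WeightedGraph where
  l : ℤ
  r : ℤ
  l_lt_r : l < r
  a : ℤ → LR
  b : ℤ → Sgn
  x : ℤ → ℝ

namespace WeightedGraph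

variable (G : WeightedGraph)

/-- The columns `j ∈ [l..r]` with `a_j = L` and `b_j = -`. -/
def colsLM : Finset ℤ :=
  (Finset.Icc G.l G.r).filter fun j => G.a j = LR.L ∧ G.b j = Sgn.minus

/-- `N_{L,-}`, the number of columns of type `(L,-)`. -/
def NLM : ℕ := G.colsLM.card

/-- The number `r - l + 1` of all even columns. -/
def Ncols : ℤ := G.r - G.l + 1

/-- The set of all bijections from `[N_{L,-}]` (here `{0, …, N_{L,-} - 1}`) to the columns of
type `(L,-)`. -/
abbrev Bij : Type := Fin G.NLM ≃ {j : ℤ // j ∈ G.colsLM}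

/-- The weight `x_{σ(q)}`. -/
def xs (σ : G.Bij) (q : Fin G.NLM) : ℝ := G.x (σ q : ℤ)

/-- The group of the permutations of the `(L,-)` columns that preserve the weights. -/
def stabX : Subgroup (Equiv.Perm {j : ℤ // j ∈ G.colsLM}) where
  carrier := {ξ | ∀ i, G.x (ξ i : ℤ) = G.x (i : ℤ)}
  mul_mem' := by
    intro ξ ζ hξ hζ i
    exact (hξ (ζ i)).trans (hζ i)
  one_mem' := fun _ => rfl
  inv_mem' := by
    intro ξ hξ i
    have h := hξ (ξ⁻¹ i)
    simpa using h.symm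

/-- The coset `{ξ τ : ξ weight preserving}` of `τ`. -/
def coset (τ : G.Bij) : Set G.Bij := {σ | ∃ ξ ∈ G.stabX, σ = τ.trans ξ}

/-- The set of the distinct weights of the `(L,-)` columns. -/
def weights : Finset ℝ := G.colsLM.image G.x

/-- The number of distinct weights of the `(L,-)` columns. -/
def numWeights : ℕ := G.weights.card

/-- The `(i+1)`-st greatest element of `weights` (for `i < numWeights`; `0` otherwise). -/
def nthWeight (i : ℕ) : ℝ :=
  if h : i < G.weights.card then G.weights.orderEmbOfFin rfl (Fin.rev ⟨i, h⟩) else 0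

/-- The number of `(L,-)` columns whose weight is the `(i+1)`-st greatest one. -/
def countNth (i : ℕ) : ℕ := (G.colsLM.filter fun j => G.x j = G.nthWeight i).card

/-- `η_j^σ = |{k : k > j, x_{σ(k)} ≠ x_{σ(j)}}|`. -/
def eta (σ : G.Bij) (j : Fin G.NLM) : ℕ :=
  (Finset.univ.filter fun k => j < k ∧ G.xs σ k ≠ G.xs σ j).card

end WeightedGraph

/-- A weighted rail-yard graph with positive weights on the `(L,-)` columns, a left boundary
partition of length `N_{L,-}`, and a bijection `σ₀` listing the `(L,-)` columns by decreasing
weight. -/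
structure Model extends WeightedGraph where
  x_pos : ∀ j ∈ toWeightedGraph.colsLM, 0 < x j
  lam : Fin toWeightedGraph.NLM → ℕ
  lam_anti : Antitone lam
  sigma0 : toWeightedGraph.Bij
  sigma0_sorted : Antitone (toWeightedGraph.xs sigma0)

namespace Model

variable (M : Model)

/-- The partition `φ^{(i+1,σ)}`: the numbers `λ_j + η_j^σ`, for those `j` for which `x_{σ(j)}` is
the `(i+1)`-st greatest weight, counted with multiplicity and listed in decreasing order. -/
def phi (σ : M.Bij) (i : ℕ) : List ℕ :=
  ((Finset.univ.filter fun j => M.xs σ j = M.nthWeight i).val.map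
    fun j => M.lam j + M.eta σ j).sort (· ≥ ·)

/-- `(∏_i x_i^{|φ^{(i,σ)}|}) (∏_i s_{φ^{(i,σ)}}(1, …, 1))`, where `x_i` is the `i`-th greatest
weight. -/
def schurFactor (σ : M.Bij) : ℝ :=
  (∏ i ∈ Finset.range M.numWeights, M.nthWeight i ^ (M.phi σ i).sum) *
    ∏ i ∈ Finset.range M.numWeights, schurAtOnes (M.phi σ i)

/-- `∏_{i < j, x_{σ(i)} ≠ x_{σ(j)}} 1 / (x_{σ(i)} - x_{σ(j)})`. -/
def pairFactor (σ : M.Bij) : ℝ :=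
  ∏ p ∈ (Finset.univ : Finset (Fin M.NLM × Fin M.NLM)).filter
      (fun p => p.1 < p.2 ∧ M.xs σ p.1 ≠ M.xs σ p.2),
    1 / (M.xs σ p.1 - M.xs σ p.2)

/-- The set `J_{i+1}` of those `t` for which some `q` has `λ_q = μ_t` and `x_{σ₀(q)}` the
`(i+1)`-st greatest weight. -/
def J {s : ℕ} (μ : Fin s → ℕ) (i : ℕ) : Set (Fin s) :=
  {t | ∃ q : Fin M.NLM, M.xs M.sigma0 q = M.nthWeight i ∧ M.lam q = μ t}

/-- The boundary partition consists of `K_s` parts `μ_1`, then `K_{s-1}` parts `μ_2`, …, and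
finally `K_1` parts `μ_s`, where `μ_1 > … > μ_s` and all `K_t` are positive. -/
structure HasBlocks {s : ℕ} (μ K : Fin s → ℕ) : Prop where
  K_pos : ∀ t, 0 < K t
  K_sum : ∑ t, K t = M.NLM
  mu_anti : StrictAnti μ
  lam_eq : ∀ (t : Fin s) (q : Fin M.NLM),
    ∑ u ∈ Finset.Iio t, K u.rev ≤ q.val → q.val < ∑ u ∈ Finset.Iic t, K u.rev → M.lam q = μ t

/-- The location `A_i` of the lowest particle of the `i`-th block (counted from below) of
consecutive particles on the left boundary; the `q`-th highest particle is at `λ_q - q`. -/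
def blockBottom {s : ℕ} (μ K : Fin s → ℕ) (i : Fin s) : ℤ :=
  (μ i.rev : ℤ) - (M.NLM : ℤ) + ∑ t ∈ Finset.Iio i, (K t : ℤ)

/-- The location `B_i = A_i + K_i - 1` of the highest particle of the `i`-th block. -/
def blockTop {s : ℕ} (μ K : Fin s → ℕ) (i : Fin s) : ℤ :=
  M.blockBottom μ K i + (K i : ℤ) - 1

end Model

/-! ### The asymptotic assumptions on a family of models, as `ε → 0+` -/

/-- The graphs have left and right boundaries at `l⁽⁰⁾ < r⁽⁰⁾` in the scaling limit. -/
structure ScalingLimit (F : ℝ → Model) (l₀ r₀ : ℝ) : Prop where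
  lt : l₀ < r₀
  left : Tendsto (fun ε => ε * ((F ε).l : ℝ)) (𝓝[>] 0) (𝓝 l₀)
  right : Tendsto (fun ε => ε * ((F ε).r : ℝ)) (𝓝[>] 0) (𝓝 r₀)

/-- Piecewise boundary condition with `n` distinct weights and `s` distinct parts
`μ_1 > … > μ_s`. -/
structure PiecewiseBoundary (F : ℝ → Model) (n : ℕ) {s : ℕ} (μ K : ℝ → Fin s → ℕ) : Prop where
  numWeights_eq : ∀ᶠ ε in 𝓝[>] (0 : ℝ), (F ε).numWeights = n
  blocks : ∀ᶠ ε in 𝓝[>] (0 : ℝ), (F ε).HasBlocks (μ ε) (K ε)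
  J_lt : ∀ᶠ ε in 𝓝[>] (0 : ℝ), ∀ i₁ i₂ : ℕ, i₁ < i₂ → i₂ < n →
    ∀ ℓ ∈ (F ε).J (μ ε) i₁, ∀ t ∈ (F ε).J (μ ε) i₂, ℓ < t
  gaps : ∃ C₁ C₂ : ℝ, 0 < C₁ ∧ 0 < C₂ ∧ ∀ᶠ ε in 𝓝[>] (0 : ℝ), ∀ p q : Fin s, p < q →
    C₁ * (F ε).NLM ≤ (μ ε p : ℝ) - (μ ε q : ℝ) ∧ (μ ε p : ℝ) - (μ ε q : ℝ) ≤ C₂ * (F ε).NLM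

/-- `A_i = a_i N_{L,-} + o(N_{L,-})` and `B_i = b_i N_{L,-} + o(N_{L,-})`. -/
structure BoundaryLimit (F : ℝ → Model) {s : ℕ} (μ K : ℝ → Fin s → ℕ) (a b : Fin s → ℝ) :
    Prop where
  bottom : ∀ i, (fun ε => ((F ε).blockBottom (μ ε) (K ε) i : ℝ) - a i * ((F ε).NLM : ℝ))
    =o[𝓝[>] 0] fun ε => ((F ε).NLM : ℝ)
  top : ∀ i, (fun ε => ((F ε).blockTop (μ ε) (K ε) i : ℝ) - b i * ((F ε).NLM : ℝ))
    =o[𝓝[>] 0] fun ε => ((F ε).NLM : ℝ)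

/-- The greatest weight is a positive constant, and
`liminf_{ε → 0+} ε log (min_{x_i > x_j} x_i / x_j) ≥ α`, the minimum being over `(L,-)` columns.
The minimum is taken outside of the increasing function `ε log`, in the extended reals. -/
structure WeightSeparation (F : ℝ → Model) (α : ℝ) : Prop where
  max_const : ∃ x₀ : ℝ, 0 < x₀ ∧
    ∀ᶠ ε in 𝓝[>] (0 : ℝ), ∀ q : Fin (F ε).NLM, q.val = 0 → (F ε).xs (F ε).sigma0 q = x₀
  separated : (α : EReal) ≤ liminf (fun ε : ℝ =>
    ⨅ p ∈ ((F ε).colsLM ×ˢ (F ε).colsLM).filter (fun p => (F ε).x p.2 < (F ε).x p.1),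
      ((ε * Real.log ((F ε).x p.1 / (F ε).x p.2) : ℝ) : EReal)) (𝓝[>] (0 : ℝ))

/-- The proportion of columns with the `i`-th greatest weight among the `(L,-)` columns tends to
`θ_i ∈ (0,1)`, and the proportion of the `(L,-)` columns among all columns tends to `ρ ∈ (0,1]`. -/
structure Proportions (F : ℝ → Model) {n : ℕ} (θ : Fin n → ℝ) (ρ : ℝ) : Prop where
  theta_mem : ∀ i, θ i ∈ Set.Ioo (0 : ℝ) 1
  theta_sum : ∑ i, θ i = 1
  theta_lim : ∀ i : Fin n,
    Tendsto (fun ε => ((F ε).countNth i.val : ℝ) / ((F ε).NLM : ℝ)) (𝓝[>] 0) (𝓝 (θ i))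
  rho_mem : ρ ∈ Set.Ioc (0 : ℝ) 1
  rho_lim : Tendsto (fun ε => ((F ε).NLM : ℝ) / ((F ε).Ncols : ℝ)) (𝓝[>] 0) (𝓝 ρ)

end RailYard

end

namespace RailYard

/-! By the Weyl dimension formula, a Schur factor is, up to a constant depending only on the class
size, a product of differences of shifted parts. The shift `η` is exactly what turns positions
inside a weight class into global positions `λ_j - j`, so these differences are particle distances.
The pair factor has the same absolute value for every `σ`. Hence the ratio is `exp` of a difference
of `logWeight`s (`abs_schurFactor_div_mul_abs_pairFactor_div`).

That difference is bounded in `logWeight_sub_ge`. If consecutive classes differ by at least `g` in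
log weight and by at least `G` in `λ`, a rearrangement inequality gains `g * G / 2` for every index
whose class changes. The terms from `η` are maximal for the sorted order. Only pairs containing a
moved index can gain from particle distances, costing at most `2 * N * log R` per moved index.

Asymptotically `g` and `N` have order `1/ε` and `G` has order `N`, so the gain is of order `α *
ε⁻²`, while `N * log N = o(ε⁻²)`. At least one index moves when `σ` lies outside the coset. -/

/-! ### Schur functions at `(1, …, 1)`. -/

/-- Counts monomials as multisets. The range `-n ≤ r < 0`, where both sides vanish, is needed for
the Jacobi–Trudi entries. -/
theorem eval_one_completeHomogeneous (n : ℕ) (r : ℤ) (h : 0 ≤ r + n) :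
    MvPolynomial.eval (fun _ => (1 : ℝ)) (completeHomogeneous (Fin (n + 1)) r) =
      (((r + n).toNat.choose n : ℕ) : ℝ) := by
  unfold completeHomogeneous
  split_ifs with hr
  · obtain ⟨k, rfl⟩ := Int.eq_ofNat_of_zero_le hr
    have h1 : ((k : ℤ) + n).toNat = n + k := by omega
    rw [h1, MvPolynomial.hsymm, map_sum, Finset.sum_congr rfl (g := fun _ => (1 : ℝ))]
    · simp only [Finset.sum_const, Finset.card_univ, nsmul_eq_mul, mul_one,
        Int.toNat_natCast]
      rw [Sym.card_sym_eq_choose, Fintype.card_fin]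
      congr 1
      rw [show n + 1 + k - 1 = n + k by omega, Nat.choose_symm_add]
    · intro m _
      rw [map_multiset_prod, Multiset.map_map]
      simp
  · rw [map_zero, Nat.choose_eq_zero_of_lt (by omega), Nat.cast_zero]

/-- Reversing the rows gives a unitriangular matrix and costs only a sign. -/
theorem abs_det_choose_rev (n : ℕ) :
    |(Matrix.of fun k q : Fin (n + 1) => ((q.val.choose (n - k.val) : ℕ) : ℝ)).det| = 1 := by
  have h := Matrix.abs_det_submatrix_equiv_equiv (Fin.revPerm (n := n + 1)) (Equiv.refl _)
    (Matrix.of fun k q : Fin (n + 1) => ((q.val.choose (n - k.val) : ℕ) : ℝ))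
  rw [← h, Matrix.det_of_isUpperTriangular]
  · rw [Finset.prod_eq_one]
    · simp
    · intro i _
      simp only [Matrix.submatrix_apply, Fin.revPerm_apply, Equiv.refl_apply, Matrix.of_apply,
        Fin.val_rev]
      rw [show n - (n + 1 - (i.val + 1)) = i.val by omega]
      simp
  · intro i j hij
    simp only [Matrix.submatrix_apply, Fin.revPerm_apply, Equiv.refl_apply, Matrix.of_apply,
      Fin.val_rev]
    rw [Nat.choose_eq_zero_of_lt, Nat.cast_zero]
    have : j.val < i.val := hij
    omega

/-- `k! * choose v k` is a monic polynomial of degree `k` in `v`, so column operations reduce to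
Vandermonde. -/
theorem det_choose {n : ℕ} (v : Fin n → ℕ) :
    (Matrix.of fun p k : Fin n => (((v p).choose k.val : ℕ) : ℝ)).det =
      (∏ k : Fin n, (k.val.factorial : ℝ))⁻¹ * (Matrix.vandermonde fun p => (v p : ℝ)).det := by
  have h := Matrix.det_eval_matrixOfPolynomials_eq_det_vandermonde (fun p => (v p : ℝ))
      (fun i : Fin n => descPochhammer ℝ i)
      (fun i => descPochhammer_natDegree ℝ i)
      (fun i => monic_descPochhammer ℝ i)
  have h2 : (Matrix.of fun i j : Fin n => (descPochhammer ℝ j.val).eval (v i : ℝ)) =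
      Matrix.of fun p k : Fin n => (k.val.factorial : ℝ) *
        (Matrix.of (fun p k : Fin n => (((v p).choose k.val : ℕ) : ℝ))) p k := by
    ext i j
    simp only [Matrix.of_apply]
    rw [descPochhammer_eval_eq_descFactorial, Nat.descFactorial_eq_factorial_mul_choose]
    push_cast; rfl
  rw [h, h2, Matrix.det_mul_row, ← mul_assoc, inv_mul_cancel₀, one_mul]
  exact Finset.prod_ne_zero_iff.2 fun k _ => by positivity

/-- The Weyl dimension formula, up to sign. -/
theorem abs_schurAtOnes {m : ℕ} (φ : List ℕ) (hm : φ.length = m) (f : Fin m → ℕ)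
    (hf : ∀ i, φ.get (i.cast hm.symm) = f i) :
    |schurAtOnes φ| = (∏ k : Fin m, (k.val.factorial : ℝ))⁻¹ *
      ∏ p : Fin m, ∏ q ∈ Finset.Ioi p,
        |((f q : ℝ) - (q.val : ℝ)) - ((f p : ℝ) - (p.val : ℝ))| := by
  subst hm
  obtain rfl : φ.get = f := funext hf
  unfold schurAtOnes schurPoly
  have key : ∀ (m : ℕ) (f : Fin m → ℕ), |MvPolynomial.eval (fun _ => (1 : ℝ))
      (Matrix.det (Matrix.of fun p q : Fin m =>
        completeHomogeneous (Fin m) ((f p : ℤ) - (p.val : ℤ) + (q.val : ℤ))))| =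
      (∏ k : Fin m, (k.val.factorial : ℝ))⁻¹ * ∏ p : Fin m, ∏ q ∈ Finset.Ioi p,
        |((f q : ℝ) - (q.val : ℝ)) - ((f p : ℝ) - (p.val : ℝ))| := by
    intro m f
    rcases m with _ | n
    · simp
    rw [RingHom.map_det]
    -- Vandermonde's convolution for `choose ((f p + n - p) + q) n` factors the Jacobi–Trudi matrix;
    -- the second factor has determinant `±1`.
    have h : (MvPolynomial.eval (fun _ => (1 : ℝ))).mapMatrix (Matrix.of fun p q : Fin (n + 1) =>
        completeHomogeneous (Fin (n + 1)) ((f p : ℤ) - (p.val : ℤ) + (q.val : ℤ))) =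
        (Matrix.of fun p k : Fin (n + 1) => (((f p + n - p.val).choose k.val : ℕ) : ℝ)) *
        Matrix.of fun k q : Fin (n + 1) => ((q.val.choose (n - k.val) : ℕ) : ℝ) := by
      ext p q
      rw [RingHom.mapMatrix_apply, Matrix.map_apply, Matrix.of_apply,
        eval_one_completeHomogeneous _ _ (by omega), Matrix.mul_apply]
      rw [show ((f p : ℤ) - (p.val : ℤ) + (q.val : ℤ) + n).toNat = (f p + n - p.val) + q.val by
        omega, Nat.add_choose_eq, Finset.Nat.sum_antidiagonal_eq_sum_range_succ_mk,
        Finset.sum_range]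
      simp
    rw [h, Matrix.det_mul, abs_mul, abs_det_choose_rev, mul_one, det_choose, abs_mul,
      Matrix.det_vandermonde, abs_of_nonneg (a := (∏ k : Fin (n + 1), (k.val.factorial : ℝ))⁻¹)
        (by positivity), Finset.abs_prod]
    congr 1
    refine Finset.prod_congr rfl fun p _ => ?_
    rw [Finset.abs_prod]
    refine Finset.prod_congr rfl fun q _ => ?_
    congr 1
    rw [Nat.cast_sub (by omega), Nat.cast_sub (by omega)]
    push_cast
    ring
  exact key _ _

/-! ### The Schur factor of one weight class in terms of particle positions. -/

theorem val_eq_card_filter_lt_orderEmbOfFin {N : ℕ} (S : Finset (Fin N)) (p : Fin S.card) :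
    p.val = (S.filter fun l => l < S.orderEmbOfFin rfl p).card := by
  have h : S.filter (fun l => l < S.orderEmbOfFin rfl p) =
      (Finset.Iio p).map (S.orderEmbOfFin rfl).toEmbedding := by
    ext l
    simp only [Finset.mem_filter, Finset.mem_map, Finset.mem_Iio]
    constructor
    · rintro ⟨hl, hlt⟩
      have : l ∈ Set.range (S.orderEmbOfFin rfl) := by
        rw [Finset.range_orderEmbOfFin]; exact hl
      obtain ⟨q, rfl⟩ := this
      exact ⟨q, (S.orderEmbOfFin rfl).lt_iff_lt.1 hlt, rfl⟩
    · rintro ⟨q, hq, rfl⟩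
      exact ⟨Finset.orderEmbOfFin_mem _ _ _, (S.orderEmbOfFin rfl).lt_iff_lt.2 hq⟩
  rw [h, Finset.card_map, Fin.card_Iio]

/-- The rank of `j` in `S` and the number of later outsiders combine so that `η_j` minus the rank is
`-j` plus a constant `N - |S|`. -/
theorem card_filter_lt_add_card {N : ℕ} (S : Finset (Fin N)) (j : Fin N) (hj : j ∈ S) :
    (S.filter fun l => l < j).card + N =
      S.card + j.val + (Finset.univ.filter fun k => j < k ∧ k ∉ S).card := by
  have h1 : (S.filter fun l => l < j).card + (S.filter fun l => j < l).card + 1 = S.card := by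
    rw [← Finset.card_filter_add_card_filter_not (s := S) (fun l => l < j), add_assoc]
    congr 1
    have : S.filter (fun l => ¬ l < j) = insert j (S.filter fun l => j < l) := by
      ext l
      simp only [Finset.mem_filter, Finset.mem_insert, not_lt]
      constructor
      · rintro ⟨h, h'⟩
        rcases h'.eq_or_lt with h'' | h''
        · exact Or.inl h''.symm
        · exact Or.inr ⟨h, h''⟩
      · rintro (rfl | ⟨h, h'⟩)
        · exact ⟨hj, le_rfl⟩
        · exact ⟨h, h'.le⟩
    rw [this, Finset.card_insert_of_notMem (by simp)]
  have h2 : (S.filter fun l => j < l).card +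
      (Finset.univ.filter fun k => j < k ∧ k ∉ S).card = N - 1 - j.val := by
    rw [← Fin.card_Ioi, ← Finset.card_filter_add_card_filter_not (s := Finset.Ioi j)
      (fun l => l ∈ S)]
    congr 2
    · ext l; simp [and_comm]
    · ext l; simp
  have := j.isLt
  omega

theorem abs_schurAtOnes_sort {N : ℕ} (S : Finset (Fin N)) (lam g : Fin N → ℕ)
    (hlam : Antitone lam)
    (hg : ∀ j ∈ S, g j = lam j + (Finset.univ.filter fun k => j < k ∧ k ∉ S).card) :
    |schurAtOnes ((S.val.map g).sort (· ≥ ·))| =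
      (∏ k : Fin S.card, (k.val.factorial : ℝ))⁻¹ *
      ∏ p ∈ (Finset.univ : Finset (Fin N × Fin N)).filter
        (fun p => p.1 < p.2 ∧ p.1 ∈ S ∧ p.2 ∈ S),
        ((lam p.1 : ℝ) - (lam p.2 : ℝ) + ((p.2.val : ℝ) - (p.1.val : ℝ))) := by
  set e := S.orderEmbOfFin rfl with he
  have heS : ∀ p, e p ∈ S := fun p => Finset.orderEmbOfFin_mem _ _ _
  -- Later members of `S` have fewer outsiders after them, so sorting merely lists `S` in its own
  -- order.
  have hanti : ∀ p q : Fin S.card, p < q → g (e q) ≤ g (e p) := by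
    intro p q hpq
    have hlt : e p < e q := e.lt_iff_lt.2 hpq
    rw [hg _ (heS p), hg _ (heS q)]
    refine add_le_add (hlam hlt.le) (Finset.card_le_card ?_)
    intro k
    simp only [Finset.mem_filter, Finset.mem_univ, true_and]
    exact fun h => ⟨hlt.trans h.1, h.2⟩
  have hlist : (S.val.map g).sort (· ≥ ·) = List.ofFn fun p => g (e p) := by
    refine List.Perm.eq_of_pairwise' (r := (· ≥ ·)) (Multiset.pairwise_sort _ _) ?_ ?_
    · rw [List.pairwise_ofFn]
      exact hanti
    · rw [← Multiset.coe_eq_coe, Multiset.sort_eq]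
      conv_lhs => rw [← Finset.map_orderEmbOfFin_univ S rfl]
      rw [Finset.map_val, Multiset.map_map]
      rw [List.ofFn_eq_map]
      rfl
  rw [hlist, abs_schurAtOnes _ (by simp) (fun p => g (e p)) (by simp)]
  congr 1
  have hval : ∀ p : Fin S.card, (g (e p) : ℝ) - (p.val : ℝ) =
      (lam (e p) : ℝ) - ((e p).val : ℝ) + (N - S.card) := by
    intro p
    have h := card_filter_lt_add_card S (e p) (heS p)
    rw [← val_eq_card_filter_lt_orderEmbOfFin] at h
    have h' := hg _ (heS p)
    have h1 : (p.val : ℝ) + N = S.card + (e p).val +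
      (Finset.univ.filter fun k => e p < k ∧ k ∉ S).card := by exact_mod_cast h
    rw [h']
    push_cast
    linarith
  simp only [hval]
  rw [Finset.prod_sigma']
  refine Finset.prod_bij (fun p _ => (e p.1, e p.2)) ?_ ?_ ?_ ?_
  · rintro ⟨p, q⟩ h
    simp only [Finset.mem_sigma, Finset.mem_univ, Finset.mem_Ioi, true_and] at h
    simp [h, heS]
  · rintro ⟨p, q⟩ _ ⟨p', q'⟩ _ h
    simp only [Prod.mk.injEq, EmbeddingLike.apply_eq_iff_eq] at h
    obtain ⟨rfl, rfl⟩ := h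
    rfl
  · rintro ⟨j, k⟩ h
    simp only [Finset.mem_filter, Finset.mem_univ, true_and] at h
    obtain ⟨hjk, hj, hk⟩ := h
    have hr : Set.range e = S := Finset.range_orderEmbOfFin _ _
    obtain ⟨p, rfl⟩ : j ∈ Set.range e := by rw [hr]; exact hj
    obtain ⟨q, rfl⟩ : k ∈ Set.range e := by rw [hr]; exact hk
    exact ⟨⟨p, q⟩, by simpa using hjk, rfl⟩
  · rintro ⟨p, q⟩ h
    simp only [Finset.mem_sigma, Finset.mem_univ, Finset.mem_Ioi, true_and] at h
    have hlt : e p < e q := e.lt_iff_lt.2 h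
    have h1 : (lam (e q) : ℝ) ≤ lam (e p) := by exact_mod_cast hlam hlt.le
    have h2 : ((e p).val : ℝ) ≤ (e q).val := by exact_mod_cast hlt.le
    rw [abs_sub_comm, abs_of_nonneg (by linarith)]
    ring

/-! ### Sums over pairs and the rearrangement inequality. -/

theorem sum_eq_two_mul_sum_lt {N : ℕ} (f : Fin N → Fin N → ℝ) (hf : ∀ i j, f i j = f j i)
    (h0 : ∀ i, f i i = 0) :
    ∑ p : Fin N × Fin N, f p.1 p.2 =
      2 * ∑ p ∈ (Finset.univ : Finset (Fin N × Fin N)).filter (fun p => p.1 < p.2), f p.1 p.2 := by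
  rw [← Finset.sum_filter_add_sum_filter_not Finset.univ (fun p : Fin N × Fin N => p.1 < p.2),
    two_mul]
  congr 1
  symm
  have h1 : ∑ p ∈ (Finset.univ : Finset (Fin N × Fin N)).filter (fun p => ¬ p.1 < p.2),
      f p.1 p.2 = ∑ p ∈ (Finset.univ : Finset (Fin N × Fin N)).filter (fun p => p.2 < p.1),
      f p.1 p.2 := by
    symm
    refine Finset.sum_subset ?_ ?_
    · intro p
      simp only [Finset.mem_filter, Finset.mem_univ, true_and, not_lt]
      exact fun h => h.le
    · intro p
      simp only [Finset.mem_filter, Finset.mem_univ, true_and, not_lt]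
      intro h h'
      rw [le_antisymm h' h, h0]
  rw [h1]
  refine Finset.sum_nbij' Prod.swap Prod.swap ?_ ?_ ?_ ?_ ?_ <;> simp
  exact fun a b _ => hf a b

theorem sum_lt_comp_perm {N : ℕ} (f : Fin N → Fin N → ℝ) (hf : ∀ i j, f i j = f j i)
    (h0 : ∀ i, f i i = 0) (π : Equiv.Perm (Fin N)) :
    ∑ p ∈ (Finset.univ : Finset (Fin N × Fin N)).filter (fun p => p.1 < p.2), f (π p.1) (π p.2) =
      ∑ p ∈ (Finset.univ : Finset (Fin N × Fin N)).filter (fun p => p.1 < p.2), f p.1 p.2 := by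
  have h1 := sum_eq_two_mul_sum_lt f hf h0
  have h2 := sum_eq_two_mul_sum_lt (fun i j => f (π i) (π j)) (fun i j => hf _ _) (fun i => h0 _)
  have h3 : ∑ p : Fin N × Fin N, f (π p.1) (π p.2) = ∑ p : Fin N × Fin N, f p.1 p.2 :=
    Equiv.sum_comp (π.prodCongr π) fun p => f p.1 p.2
  linarith

/-- The one-level drops telescope because no level is skipped. Compensated monotonicity is the form
in which gaps enter the rearrangement argument. -/
theorem antitone_add_mul_of_gap {N : ℕ} {f : Fin N → ℝ} {c : Fin N → ℕ} {G : ℝ}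
    (hf : Antitone f) (hc : Monotone c) (honto : ∀ k, ∀ i ≤ c k, ∃ q, c q = i)
    (hgap : ∀ j k, c k = c j + 1 → f k + G ≤ f j) :
    Antitone fun q => f q + G * c q := by
  have key : ∀ (d : ℕ) (j k : Fin N), c k = c j + d + 1 → f k + G * (d + 1) ≤ f j := by
    intro d
    induction d with
    | zero => intro j k h; simpa using hgap j k h
    | succ d ih =>
      intro j k h
      obtain ⟨q, hq⟩ := honto k (c j + d + 1) (by omega)
      have h1 := ih j q hq
      have h2 := hgap q k (by omega)
      push_cast
      linarith
  intro j k hjk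
  rcases (hc hjk).eq_or_lt with h | h
  · simp only [h]
    linarith [hf hjk]
  · obtain ⟨d, hd⟩ := Nat.exists_eq_add_of_lt h
    have := key d j k hd
    simp only [hd]
    push_cast
    linarith

/-- A quantitative rearrangement inequality for functions that drop by at least `G`, `g`
between consecutive levels of `c`. -/
theorem gap_mul_card_le_sum {N : ℕ} {f y : Fin N → ℝ} {c : Fin N → ℕ} {g G : ℝ}
    (hg : 0 ≤ g) (hG : 0 ≤ G) (hc : Monotone c)
    (hf : Antitone fun q => f q + G * c q) (hy : Antitone fun q => y q + g * c q)
    (π : Equiv.Perm (Fin N)) :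
    g * G / 2 * (Finset.univ.filter fun q => c (π q) ≠ c q).card ≤
      ∑ q, f q * (y q - y (π q)) := by
  have hcr : Monotone fun q => (c q : ℝ) := fun i j h => Nat.cast_le.2 (hc h)
  have hy' : Antitone y := by
    intro i j h
    have h1 := hy h
    have h2 := mul_le_mul_of_nonneg_left (hcr h) hg
    simp only at h1 h2
    linarith
  have e1 : 0 ≤ ∑ q, (f q + G * c q) * (y q - y (π q)) := by
    have := (hf.monovary hy').sum_mul_comp_perm_le_sum_mul (σ := π)
    simp only [mul_sub, Finset.sum_sub_distrib]
    linarith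
  have e2 : 0 ≤ ∑ q, (c q : ℝ) * ((y (π q) + g * c (π q)) - (y q + g * c q)) := by
    have := (hcr.antivary hy).sum_mul_le_sum_mul_comp_perm (σ := π)
    simp only [mul_sub (c _ : ℝ), Finset.sum_sub_distrib]
    linarith
  -- Since `π` preserves the sum of squares, the right side is `∑ (c q - c (π q))²`, and each moved
  -- integer level contributes at least 1.
  have e3 : ((Finset.univ.filter fun q => c (π q) ≠ c q).card : ℝ) ≤
      2 * ∑ q, (c q : ℝ) * (c q - c (π q)) := by
    have h1 : ∑ q, (c (π q) : ℝ) ^ 2 = ∑ q, (c q : ℝ) ^ 2 :=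
      Equiv.sum_comp π fun q => (c q : ℝ) ^ 2
    have h2 : 2 * ∑ q, (c q : ℝ) * (c q - c (π q)) = ∑ q, ((c q : ℝ) - c (π q)) ^ 2 := by
      have : ∑ q, ((c q : ℝ) - c (π q)) ^ 2 = ∑ q, 2 * ((c q : ℝ) * (c q - c (π q))) +
          (∑ q, (c (π q) : ℝ) ^ 2 - ∑ q, (c q : ℝ) ^ 2) := by
        rw [← Finset.sum_sub_distrib, ← Finset.sum_add_distrib]
        exact Finset.sum_congr rfl fun q _ => by ring
      rw [this, h1, Finset.mul_sum]
      ring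
    rw [h2, Finset.card_filter]
    push_cast
    refine Finset.sum_le_sum fun q _ => ?_
    split_ifs with h
    · have h3 : (1 : ℤ) ≤ ((c q : ℤ) - c (π q)) ^ 2 := by
        have : ((c q : ℤ) - c (π q)) ≠ 0 := by omega
        have := sq_pos_of_ne_zero this
        omega
      exact_mod_cast h3
    · positivity
  -- Splitting off the staircases `G * c` and `g * c` leaves two nonnegative rearrangement terms and
  -- the pure staircase term.
  have e4 : ∑ q, f q * (y q - y (π q)) = ∑ q, (f q + G * c q) * (y q - y (π q)) +
      G * (∑ q, (c q : ℝ) * ((y (π q) + g * c (π q)) - (y q + g * c q))) +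
      g * G * ∑ q, (c q : ℝ) * (c q - c (π q)) := by
    rw [Finset.mul_sum, Finset.mul_sum, ← Finset.sum_add_distrib, ← Finset.sum_add_distrib]
    exact Finset.sum_congr rfl fun q _ => by ring
  have e5 := mul_le_mul_of_nonneg_left e3 (mul_nonneg hg hG)
  have e6 := mul_nonneg hG e2
  linarith

theorem card_pairs_le {N : ℕ} (T : Finset (Fin N)) (P : Finset (Fin N × Fin N))
    (hP : ∀ p ∈ P, p.1 ∈ T ∨ p.2 ∈ T) : P.card ≤ 2 * (T.card * N) := by
  have : P ⊆ (T ×ˢ Finset.univ) ∪ (Finset.univ ×ˢ T) := by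
    intro p hp
    simpa using hP p hp
  refine (Finset.card_le_card this).trans ((Finset.card_union_le _ _).trans ?_)
  simp only [Finset.card_product, Finset.card_univ, Fintype.card_fin]
  rw [mul_comm N]
  omega

/-- The logarithm of the weight of an arrangement, up to a term that is independent of the
arrangement; `z` are the logarithms of the weights in the order of the arrangement. -/
noncomputable def logWeight {N : ℕ} (f : Fin N → ℝ) (D : Fin N → Fin N → ℝ) (z : Fin N → ℝ) : ℝ :=
  ∑ q, f q * z q +
    ∑ p ∈ (Finset.univ : Finset (Fin N × Fin N)).filter (fun p => p.1 < p.2),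
      (if z p.1 = z p.2 then D p.1 p.2 else z p.1)

/-- The rearrangement gain of the linear term outweighs what the pair terms can lose. -/
theorem logWeight_sub_ge {N : ℕ} {f y : Fin N → ℝ} {c : Fin N → ℕ} {D : Fin N → Fin N → ℝ}
    {g G L : ℝ} (hg : 0 ≤ g) (hG : 0 ≤ G) (hc : Monotone c)
    (hf : Antitone fun q => f q + G * c q) (hy : Antitone fun q => y q + g * c q)
    (hcy : ∀ i j, c i = c j ↔ y i = y j)
    (hD0 : ∀ i j, i < j → 0 ≤ D i j) (hDL : ∀ i j, i < j → D i j ≤ L) (hL : 0 ≤ L)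
    (π : Equiv.Perm (Fin N)) :
    (g * G / 2 - 2 * N * L) * (Finset.univ.filter fun q => c (π q) ≠ c q).card ≤
      logWeight f D y - logWeight f D (y ∘ π) := by
  set T := Finset.univ.filter fun q => c (π q) ≠ c q with hT
  set U := (Finset.univ : Finset (Fin N × Fin N)).filter (fun p => p.1 < p.2) with hU
  have hy' : Antitone y := by
    intro i j h
    have h1 := hy h
    have h2 := mul_le_mul_of_nonneg_left (Nat.cast_le (α := ℝ).2 (hc h)) hg
    simp only at h1 h2
    linarith
  have e1 := gap_mul_card_le_sum hg hG hc hf hy π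
  -- A permutation-invariant benchmark: it dominates the unequal-pair terms of any arrangement and
  -- equals them for the sorted one.
  set mx : Fin N → Fin N → ℝ := fun i j => if y i = y j then 0 else max (y i) (y j) with hmx
  have e2 : ∑ p ∈ U, mx (π p.1) (π p.2) = ∑ p ∈ U, mx p.1 p.2 := by
    refine sum_lt_comp_perm mx ?_ ?_ π
    · intro i j
      simp only [hmx, eq_comm (a := y i), max_comm (y i)]
    · intro i
      simp [hmx]
  -- The only pairs where the rearranged order can win: newly in one class, hence containing a moved
  -- index.
  set Q := U.filter fun p => y (π p.1) = y (π p.2) ∧ y p.1 ≠ y p.2 with hQ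
  have e3 : (Q.card : ℝ) * L ≤ 2 * N * L * T.card := by
    have h1 : Q.card ≤ 2 * (T.card * N) := by
      refine card_pairs_le T Q ?_
      intro p hp
      simp only [hQ, hT, Finset.mem_filter, Finset.mem_univ, true_and] at hp ⊢
      by_contra! hcon
      have h2 := hp.2.1
      rw [← hcy, hcon.1, hcon.2, hcy] at h2
      exact hp.2.2 h2
    have h2 : (Q.card : ℝ) ≤ 2 * (T.card * N) := by exact_mod_cast h1
    nlinarith
  have e4 : ∑ p ∈ U, (if y (π p.1) = y (π p.2) then D p.1 p.2 else y (π p.1)) -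
      ∑ p ∈ U, mx (π p.1) (π p.2) ≤
      ∑ p ∈ U, (if y p.1 = y p.2 then D p.1 p.2 else y p.1) - ∑ p ∈ U, mx p.1 p.2 +
      Q.card * L := by
    have : (Q.card : ℝ) * L = ∑ p ∈ U,
        if y (π p.1) = y (π p.2) ∧ y p.1 ≠ y p.2 then L else 0 := by
      rw [← Finset.sum_filter, Finset.sum_const, nsmul_eq_mul]
    rw [this, ← Finset.sum_sub_distrib, ← Finset.sum_sub_distrib, ← Finset.sum_add_distrib]
    refine Finset.sum_le_sum fun p hp => ?_
    have hlt : p.1 < p.2 := by simpa [hU] using hp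
    have h0 := hD0 _ _ hlt
    have h1 := hDL _ _ hlt
    have h2 : max (y p.1) (y p.2) = y p.1 := max_eq_left (hy' hlt.le)
    have h3 := le_max_left (y (π p.1)) (y (π p.2))
    simp only [hmx]
    by_cases ha : y (π p.1) = y (π p.2) <;> by_cases hb : y p.1 = y p.2 <;>
      simp only [ha, hb, h2, if_true, if_false, true_and, false_and, ne_eq, not_true_eq_false,
        not_false_eq_true] <;> linarith
  have e5 : ∑ q, f q * (y q - y (π q)) = ∑ q, f q * y q - ∑ q, f q * y (π q) := by
    simp only [mul_sub, Finset.sum_sub_distrib]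
  simp only [logWeight, Function.comp]
  linarith

/-! ### Enumeration of the distinct weights. -/

namespace WeightedGraph

variable (G : WeightedGraph)

theorem nthWeight_mem {i : ℕ} (hi : i < G.numWeights) : G.nthWeight i ∈ G.weights := by
  unfold numWeights at hi
  unfold nthWeight
  rw [dif_pos hi]
  exact Finset.orderEmbOfFin_mem _ _ _

theorem nthWeight_lt {i j : ℕ} (hij : i < j) (hj : j < G.numWeights) :
    G.nthWeight j < G.nthWeight i := by
  unfold numWeights at hj
  unfold nthWeight
  rw [dif_pos hj, dif_pos (hij.trans hj), OrderEmbedding.lt_iff_lt, Fin.rev_lt_rev]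
  exact hij

theorem nthWeight_inj {i j : ℕ} (hi : i < G.numWeights) (hj : j < G.numWeights)
    (h : G.nthWeight i = G.nthWeight j) : i = j := by
  rcases lt_trichotomy i j with h' | h' | h'
  · exact absurd h (G.nthWeight_lt h' hj).ne'
  · exact h'
  · exact absurd h (G.nthWeight_lt h' hi).ne

theorem exists_nthWeight_eq {v : ℝ} (hv : v ∈ G.weights) :
    ∃ i < G.numWeights, G.nthWeight i = v := by
  have h : v ∈ Set.range (G.weights.orderEmbOfFin rfl) := by
    rw [Finset.range_orderEmbOfFin]
    exact hv
  obtain ⟨p, rfl⟩ := h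
  refine ⟨p.rev, p.rev.isLt, ?_⟩
  unfold nthWeight
  rw [dif_pos p.rev.isLt, Fin.eta, Fin.rev_rev]

theorem xs_mem_weights (σ : G.Bij) (q : Fin G.NLM) : G.xs σ q ∈ G.weights :=
  Finset.mem_image_of_mem _ (σ q).2

/-- The index of the weight of the `q`-th column in the decreasing list of all weights. -/
noncomputable def weightIndex (σ : G.Bij) (q : Fin G.NLM) : ℕ :=
  (G.exists_nthWeight_eq (G.xs_mem_weights σ q)).choose

theorem weightIndex_lt (σ : G.Bij) (q : Fin G.NLM) : G.weightIndex σ q < G.numWeights :=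
  (G.exists_nthWeight_eq (G.xs_mem_weights σ q)).choose_spec.1

theorem nthWeight_weightIndex (σ : G.Bij) (q : Fin G.NLM) :
    G.nthWeight (G.weightIndex σ q) = G.xs σ q :=
  (G.exists_nthWeight_eq (G.xs_mem_weights σ q)).choose_spec.2

theorem xs_eq_nthWeight_iff (σ : G.Bij) (q : Fin G.NLM) {i : ℕ} (hi : i < G.numWeights) :
    G.xs σ q = G.nthWeight i ↔ G.weightIndex σ q = i := by
  rw [← G.nthWeight_weightIndex]
  exact ⟨G.nthWeight_inj (G.weightIndex_lt σ q) hi, fun h => by rw [h]⟩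

theorem xs_eq_xs_iff (σ τ : G.Bij) (q r : Fin G.NLM) :
    G.xs σ q = G.xs τ r ↔ G.weightIndex σ q = G.weightIndex τ r := by
  rw [← G.nthWeight_weightIndex τ, G.xs_eq_nthWeight_iff _ _ (G.weightIndex_lt _ _)]

theorem card_filter_xs_eq (σ : G.Bij) (i : ℕ) :
    (Finset.univ.filter fun q => G.xs σ q = G.nthWeight i).card = G.countNth i := by
  refine Finset.card_bij (fun q _ => (σ q : ℤ)) ?_ ?_ ?_
  · intro q hq
    simp only [Finset.mem_filter, Finset.mem_univ, true_and] at hq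
    exact Finset.mem_filter.2 ⟨(σ q).2, hq⟩
  · intro q _ r _ h
    exact σ.injective (Subtype.ext h)
  · intro j hj
    obtain ⟨h1, h2⟩ := Finset.mem_filter.1 hj
    refine ⟨σ.symm ⟨j, h1⟩, ?_, by simp⟩
    refine Finset.mem_filter.2 ⟨Finset.mem_univ _, ?_⟩
    simpa [xs] using h2

theorem xs_comp (σ τ : G.Bij) (q : Fin G.NLM) :
    G.xs τ ((σ.trans τ.symm) q) = G.xs σ q := by
  simp [xs]

theorem exists_xs_ne_of_notMem_coset {σ τ : G.Bij} (h : σ ∉ G.coset τ) :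
    ∃ q, G.xs σ q ≠ G.xs τ q := by
  by_contra! hcon
  refine h ⟨τ.symm.trans σ, ?_, ?_⟩
  · intro i
    have := hcon (τ.symm i)
    simpa [xs] using this
  · ext q
    simp

end WeightedGraph

/-! ### The ratio for a fixed model. -/

namespace Model

variable (M : Model)

theorem xs_pos (σ : M.Bij) (q : Fin M.NLM) : 0 < M.xs σ q := M.x_pos _ (σ q).2

theorem nthWeight_pos {i : ℕ} (hi : i < M.numWeights) : 0 < M.nthWeight i := by
  obtain ⟨j, hj, h⟩ := Finset.mem_image.1 (M.nthWeight_mem hi)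
  rw [← h]
  exact M.x_pos _ hj

/-- The logarithm of the number of positions spanned by the `j`-th and the `k`-th particle. -/
noncomputable def logDist (j k : Fin M.NLM) : ℝ :=
  Real.log ((M.lam j : ℝ) - (M.lam k : ℝ) + ((k.val : ℝ) - (j.val : ℝ)))

theorem one_le_dist {j k : Fin M.NLM} (h : j < k) :
    1 ≤ (M.lam j : ℝ) - (M.lam k : ℝ) + ((k.val : ℝ) - (j.val : ℝ)) := by
  have h1 : (M.lam k : ℝ) ≤ M.lam j := by exact_mod_cast M.lam_anti h.le
  have h2 : (j.val : ℝ) + 1 ≤ k.val := by exact_mod_cast h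
  linarith

theorem sum_phi (σ : M.Bij) (i : ℕ) :
    (M.phi σ i).sum = ∑ j with M.xs σ j = M.nthWeight i, (M.lam j + M.eta σ j) := by
  rw [phi, ← Multiset.sum_coe, Multiset.sort_eq]
  rfl

/-- The normalization of the Schur factors, which only depends on the class sizes. -/
noncomputable def schurNorm : ℝ :=
  ∏ i ∈ Finset.range M.numWeights, (∏ k : Fin (M.countNth i), (k.val.factorial : ℝ))⁻¹

theorem schurNorm_pos : 0 < M.schurNorm := by
  unfold schurNorm
  refine Finset.prod_pos fun i _ => inv_pos.2 (Finset.prod_pos fun k _ => ?_)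
  positivity

theorem abs_schurAtOnes_phi (σ : M.Bij) {i : ℕ} :
    |schurAtOnes (M.phi σ i)| = (∏ k : Fin (M.countNth i), (k.val.factorial : ℝ))⁻¹ *
      Real.exp (∑ p ∈ (Finset.univ : Finset (Fin M.NLM × Fin M.NLM)).filter (fun p => p.1 < p.2 ∧
        M.xs σ p.1 = M.nthWeight i ∧ M.xs σ p.2 = M.nthWeight i), M.logDist p.1 p.2) := by
  rw [phi, abs_schurAtOnes_sort _ M.lam _ M.lam_anti, Real.exp_sum]
  · rw [M.card_filter_xs_eq]
    congr 1
    refine Finset.prod_congr ?_ ?_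
    · ext p
      simp
    · intro p hp
      simp only [Finset.mem_filter, Finset.mem_univ, true_and] at hp
      rw [logDist, Real.exp_log]
      linarith [M.one_le_dist hp.1]
  · intro j hj
    simp only [Finset.mem_filter, Finset.mem_univ, true_and] at hj ⊢
    rw [WeightedGraph.eta, hj]

theorem abs_schurFactor (σ : M.Bij) :
    |M.schurFactor σ| = M.schurNorm *
      Real.exp (logWeight (fun q => (M.lam q : ℝ)) M.logDist fun q => Real.log (M.xs σ q)) := by
  have hmaps : ∀ q ∈ (Finset.univ : Finset (Fin M.NLM)),
      M.weightIndex σ q ∈ Finset.range M.numWeights :=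
    fun q _ => Finset.mem_range.2 (M.weightIndex_lt σ q)
  have h1 : ∏ i ∈ Finset.range M.numWeights, M.nthWeight i ^ (M.phi σ i).sum =
      Real.exp (∑ q, ((M.lam q : ℝ) + M.eta σ q) * Real.log (M.xs σ q)) := by
    rw [← Finset.sum_fiberwise_of_maps_to hmaps, Real.exp_sum]
    refine Finset.prod_congr rfl fun i hi => ?_
    have hi' := Finset.mem_range.1 hi
    have e : (M.phi σ i).sum * Real.log (M.nthWeight i) =
        ∑ q with M.weightIndex σ q = i, ((M.lam q : ℝ) + M.eta σ q) * Real.log (M.xs σ q) := by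
      rw [M.sum_phi]
      push_cast
      rw [Finset.sum_mul]
      refine Finset.sum_congr ?_ ?_
      · ext q
        simp [M.xs_eq_nthWeight_iff σ q hi']
      · intro q hq
        rw [← (Finset.mem_filter.1 hq).2, M.nthWeight_weightIndex]
    rw [← e, Real.exp_nat_mul, Real.exp_log (M.nthWeight_pos hi')]
  have h2 : |∏ i ∈ Finset.range M.numWeights, schurAtOnes (M.phi σ i)| = M.schurNorm *
      Real.exp (∑ p ∈ (Finset.univ : Finset (Fin M.NLM × Fin M.NLM)).filter (fun p => p.1 < p.2),
        if M.xs σ p.1 = M.xs σ p.2 then M.logDist p.1 p.2 else 0) := by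
    rw [Finset.abs_prod]
    simp only [abs_schurAtOnes_phi]
    rw [Finset.prod_mul_distrib, schurNorm, ← Real.exp_sum]
    congr 2
    have hmaps2 : ∀ p ∈ (Finset.univ : Finset (Fin M.NLM × Fin M.NLM)).filter
        (fun p => p.1 < p.2 ∧ M.xs σ p.1 = M.xs σ p.2),
        M.weightIndex σ p.1 ∈ Finset.range M.numWeights :=
      fun p _ => Finset.mem_range.2 (M.weightIndex_lt σ p.1)
    rw [← Finset.sum_filter, Finset.filter_filter, ← Finset.sum_fiberwise_of_maps_to hmaps2]
    refine Finset.sum_congr rfl fun i hi => Finset.sum_congr ?_ fun _ _ => rfl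
    have hi' := Finset.mem_range.1 hi
    ext p
    simp only [Finset.mem_filter, Finset.mem_univ, true_and, M.xs_eq_nthWeight_iff σ _ hi',
      M.xs_eq_xs_iff]
    constructor
    · rintro ⟨a, b, c⟩
      exact ⟨⟨a, b.trans c.symm⟩, b⟩
    · rintro ⟨⟨a, b⟩, c⟩
      exact ⟨a, c, b.symm.trans c⟩
  -- Each unit of `η_q` is one later position of another weight, so the `η` part becomes a sum over
  -- pairs.
  have h3 : ∑ q, (M.eta σ q : ℝ) * Real.log (M.xs σ q) =
      ∑ p ∈ (Finset.univ : Finset (Fin M.NLM × Fin M.NLM)).filter (fun p => p.1 < p.2),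
        if M.xs σ p.1 = M.xs σ p.2 then 0 else Real.log (M.xs σ p.1) := by
    rw [Finset.sum_filter, Fintype.sum_prod_type]
    refine Finset.sum_congr rfl fun q _ => ?_
    rw [WeightedGraph.eta, ← nsmul_eq_mul, ← Finset.sum_const, Finset.sum_filter]
    refine Finset.sum_congr rfl fun k _ => ?_
    by_cases ha : q < k <;> by_cases hb : M.xs σ q = M.xs σ k <;> simp [ha, hb, eq_comm]
  rw [schurFactor, abs_mul, h2, h1, abs_of_pos (Real.exp_pos _), mul_left_comm, ← Real.exp_add]
  congr 2
  simp only [add_mul, Finset.sum_add_distrib]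
  rw [h3, logWeight, add_assoc, ← Finset.sum_add_distrib]
  congr 1
  refine Finset.sum_congr rfl fun p _ => ?_
  have hinj : Real.log (M.xs σ p.1) = Real.log (M.xs σ p.2) ↔ M.xs σ p.1 = M.xs σ p.2 :=
    ⟨fun h => Real.log_injOn_pos (M.xs_pos σ _) (M.xs_pos σ _) h, fun h => by rw [h]⟩
  by_cases h : M.xs σ p.1 = M.xs σ p.2
  · simp [h]
  · simp [h, hinj]

theorem abs_pairFactor (σ : M.Bij) :
    |M.pairFactor σ| = Real.exp (∑ p ∈ (Finset.univ : Finset (Fin M.NLM × Fin M.NLM)).filter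
      (fun p => p.1 < p.2), if M.xs σ p.1 = M.xs σ p.2 then 0 else
        -Real.log |M.xs σ p.1 - M.xs σ p.2|) := by
  rw [pairFactor, Finset.abs_prod, Real.exp_sum, ← Finset.filter_filter, Finset.prod_filter]
  refine Finset.prod_congr rfl fun p _ => ?_
  by_cases h : M.xs σ p.1 = M.xs σ p.2
  · simp [h]
  · simp only [ne_eq, h, not_false_eq_true, if_true, if_false]
    rw [Real.exp_neg, Real.exp_log (abs_pos.2 (sub_ne_zero.2 h)), one_div, abs_inv]

/-- Up to sign this is a product over unordered pairs of columns, which the listing order does not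
affect. -/
theorem abs_pairFactor_eq (σ τ : M.Bij) : |M.pairFactor σ| = |M.pairFactor τ| := by
  rw [abs_pairFactor, abs_pairFactor]
  congr 1
  rw [← sum_lt_comp_perm (fun i j => if M.xs τ i = M.xs τ j then 0 else
        -Real.log |M.xs τ i - M.xs τ j|) ?_ ?_ (σ.trans τ.symm)]
  · simp only [M.xs_comp]
  · intro i j
    simp only [eq_comm (a := M.xs τ i), abs_sub_comm (M.xs τ i)]
  · simp

theorem abs_schurFactor_div_mul_abs_pairFactor_div (σ τ : M.Bij) :
    |M.schurFactor τ / M.schurFactor σ| * |M.pairFactor τ / M.pairFactor σ| =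
      Real.exp (logWeight (fun q => (M.lam q : ℝ)) M.logDist (fun q => Real.log (M.xs τ q)) -
        logWeight (fun q => (M.lam q : ℝ)) M.logDist fun q => Real.log (M.xs σ q)) := by
  rw [abs_div, abs_div, abs_schurFactor, abs_schurFactor, M.abs_pairFactor_eq τ σ, div_self,
    mul_one, mul_div_mul_left _ _ M.schurNorm_pos.ne', Real.exp_sub]
  rw [abs_pairFactor]
  exact (Real.exp_pos _).ne'

theorem HasBlocks.exists_lam_eq {M : Model} {s : ℕ} {μ K : Fin s → ℕ} (h : M.HasBlocks μ K)
    (q : Fin M.NLM) : ∃ t, M.lam q = μ t := by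
  have hex : ∃ t : Fin s, q.val < ∑ u ∈ Finset.Iic t, K u.rev := by
    rcases s with _ | s
    · have := h.K_sum
      simp at this
      exact absurd q.isLt (by omega)
    · refine ⟨Fin.last s, ?_⟩
      have h1 : Finset.Iic (Fin.last s) = Finset.univ := by
        ext u; simp [Fin.le_last]
      have h2 : ∑ u, K (Fin.rev u) = ∑ u, K u := Equiv.sum_comp Fin.revPerm K
      rw [h1, h2, h.K_sum]
      exact q.isLt
  obtain ⟨t, ht, hmin⟩ : ∃ t : Fin s, q.val < ∑ u ∈ Finset.Iic t, K u.rev ∧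
      ∀ t' < t, ¬ q.val < ∑ u ∈ Finset.Iic t', K u.rev := by
    obtain ⟨t, ht, hmin⟩ := WellFounded.has_min (wellFounded_lt (α := Fin s))
      {t | q.val < ∑ u ∈ Finset.Iic t, K u.rev} hex
    exact ⟨t, ht, fun t' h' h'' => hmin t' h'' h'⟩
  refine ⟨t, h.lam_eq t q ?_ ht⟩
  rcases Nat.eq_zero_or_pos t.val with h0 | h0
  · have : Finset.Iio t = ∅ := by
      ext u
      simp only [Finset.mem_Iio, Fin.lt_def, h0, Finset.notMem_empty, iff_false]
      omega
    simp [this]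
  · have ht1 : t.val - 1 < s := by omega
    have : Finset.Iio t = Finset.Iic (⟨t.val - 1, ht1⟩ : Fin s) := by
      ext u
      simp only [Finset.mem_Iio, Finset.mem_Iic, Fin.lt_def, Fin.le_def]
      omega
    rw [this]
    exact not_lt.1 (hmin _ (by rw [Fin.lt_def]; simp only; omega))

/-- The non-asymptotic bound: `g` separates log weights, `G` separates parts, and `R` bounds
particle distances. -/
theorem exp_le_ratio {s : ℕ} {μ K : Fin s → ℕ} (hB : M.HasBlocks μ K)
    (hJ : ∀ i₁ i₂ : ℕ, i₁ < i₂ → i₂ < M.numWeights →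
      ∀ ℓ ∈ M.J μ i₁, ∀ t ∈ M.J μ i₂, ℓ < t)
    {g G R : ℝ} (hg : 0 < g) (hG : 0 ≤ G)
    (hgap : ∀ i ∈ M.colsLM, ∀ j ∈ M.colsLM, M.x j < M.x i → g ≤ Real.log (M.x i / M.x j))
    (hμG : ∀ p q : Fin s, p < q → G ≤ (μ p : ℝ) - μ q)
    (hμR : ∀ p q : Fin s, p < q → (μ p : ℝ) - μ q + M.NLM ≤ R)
    (hR : (M.NLM : ℝ) ≤ R) (hR1 : 1 ≤ R)
    (hpos : 0 ≤ g * G / 2 - 2 * M.NLM * Real.log R)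
    (σ : M.Bij) (hσ : σ ∉ M.coset M.sigma0) :
    Real.exp (g * G / 2 - 2 * M.NLM * Real.log R) ≤
      |M.schurFactor M.sigma0 / M.schurFactor σ| *
        |M.pairFactor M.sigma0 / M.pairFactor σ| := by
  rw [abs_schurFactor_div_mul_abs_pairFactor_div, Real.exp_le_exp]
  set c := M.weightIndex M.sigma0 with hc
  set y := fun q => Real.log (M.xs M.sigma0 q) with hy
  set π : Equiv.Perm (Fin M.NLM) := σ.trans M.sigma0.symm with hπ
  have hz : (fun q => Real.log (M.xs σ q)) = y ∘ π := by
    funext q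
    simp only [hy, hπ, Function.comp, M.xs_comp]
  rw [hz]
  have hcx : ∀ i j, c i < c j → M.xs M.sigma0 j < M.xs M.sigma0 i := by
    intro i j h
    rw [← M.nthWeight_weightIndex, ← M.nthWeight_weightIndex M.sigma0 i]
    exact M.nthWeight_lt h (M.weightIndex_lt _ _)
  have hmono : Monotone c := by
    intro i j h
    by_contra! hcon
    exact absurd (M.sigma0_sorted h) (not_le.2 (hcx j i hcon))
  have honto : ∀ k, ∀ i ≤ c k, ∃ q, c q = i := by
    intro k i hi
    have hi' : i < M.numWeights := hi.trans_lt (M.weightIndex_lt _ _)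
    obtain ⟨j, hj, hji⟩ := Finset.mem_image.1 (M.nthWeight_mem hi')
    refine ⟨M.sigma0.symm ⟨j, hj⟩, ?_⟩
    rw [hc, ← M.xs_eq_nthWeight_iff _ _ hi']
    simpa [WeightedGraph.xs] using hji
  have hlamA : Antitone fun q => (M.lam q : ℝ) := fun i j h => Nat.cast_le.2 (M.lam_anti h)
  have hyA : Antitone y := fun i j h => Real.log_le_log (M.xs_pos _ _) (M.sigma0_sorted h)
  have hcy : ∀ i j, c i = c j ↔ y i = y j := by
    intro i j
    rw [hc, ← M.xs_eq_xs_iff]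
    exact ⟨fun h => by simp only [hy, h],
      fun h => Real.log_injOn_pos (M.xs_pos _ _) (M.xs_pos _ _) h⟩
  -- The ordering of the sets `J` forces different parts in different classes, so `λ` drops by at
  -- least `G` between them.
  have hf : Antitone fun q => (M.lam q : ℝ) + G * c q := by
    refine antitone_add_mul_of_gap hlamA hmono honto fun j k h => ?_
    obtain ⟨t, ht⟩ := hB.exists_lam_eq j
    obtain ⟨t', ht'⟩ := hB.exists_lam_eq k
    have hlt : t < t' := hJ (c j) (c k) (by omega) (M.weightIndex_lt _ _) t
      ⟨j, (M.nthWeight_weightIndex _ _).symm, ht⟩ t' ⟨k, (M.nthWeight_weightIndex _ _).symm, ht'⟩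
    have := hμG t t' hlt
    rw [ht, ht']
    linarith
  have hyg : Antitone fun q => y q + g * c q := by
    refine antitone_add_mul_of_gap hyA hmono honto fun j k h => ?_
    have := hgap _ (M.sigma0 j).2 _ (M.sigma0 k).2 (hcx j k (by omega))
    rw [Real.log_div (M.x_pos _ (M.sigma0 j).2).ne' (M.x_pos _ (M.sigma0 k).2).ne'] at this
    simp only [hy, WeightedGraph.xs]
    linarith
  have hDL : ∀ i j, i < j → M.logDist i j ≤ Real.log R := by
    intro i j hij
    refine Real.log_le_log (by linarith [M.one_le_dist hij]) ?_
    obtain ⟨t, ht⟩ := hB.exists_lam_eq i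
    obtain ⟨t', ht'⟩ := hB.exists_lam_eq j
    have h1 : (j.val : ℝ) ≤ M.NLM := by exact_mod_cast j.isLt.le
    have h2 : (0 : ℝ) ≤ i.val := by positivity
    rw [ht, ht']
    rcases lt_trichotomy t t' with h | h | h
    · linarith [hμR t t' h]
    · rw [h]
      linarith
    · have h3 : (μ t : ℝ) ≤ μ t' := by exact_mod_cast (hB.mu_anti h).le
      linarith
  have main := logWeight_sub_ge (D := M.logDist) hg.le hG hmono hf hyg hcy
    (fun i j h => Real.log_nonneg (M.one_le_dist h)) hDL (Real.log_nonneg hR1) π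
  refine le_trans ?_ main
  -- Outside the coset some index changes class, so the moved set is nonempty.
  refine le_mul_of_one_le_right hpos ?_
  obtain ⟨q, hq⟩ := M.exists_xs_ne_of_notMem_coset hσ
  rw [← M.xs_comp σ M.sigma0, Ne, M.xs_eq_xs_iff] at hq
  rw [Nat.one_le_cast]
  exact Finset.card_pos.2 ⟨q, Finset.mem_filter.2 ⟨Finset.mem_univ _, hq⟩⟩

end Model

/-! ### Asymptotics as `ε → 0+`. -/

theorem exists_pos_gap {s : ℕ} (a b : Fin s → ℝ) (hba : ∀ i j, i < j → b i < a j) :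
    ∃ γ : ℝ, 0 < γ ∧ ∀ i j, i < j → γ ≤ a j - b i := by
  have h : ∀ᶠ γ in 𝓝[>] (0 : ℝ), ∀ i j, i < j → γ ≤ a j - b i := by
    refine eventually_all.2 fun i => eventually_all.2 fun j => ?_
    by_cases hij : i < j
    · have : (0 : ℝ) < a j - b i := sub_pos.2 (hba i j hij)
      filter_upwards [nhdsWithin_le_nhds (eventually_lt_nhds this)] with γ hγ _ using hγ.le
    · exact Eventually.of_forall fun γ h' => absurd h' hij
  obtain ⟨γ, h1, h2⟩ := (h.and self_mem_nhdsWithin).exists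
  exact ⟨γ, h2, h1⟩

theorem tendsto_mul_NLM {F : ℝ → Model} {l₀ r₀ ρ : ℝ} (hs : ScalingLimit F l₀ r₀)
    (hρ : Tendsto (fun ε => ((F ε).NLM : ℝ) / ((F ε).Ncols : ℝ)) (𝓝[>] 0) (𝓝 ρ)) :
    Tendsto (fun ε => ε * ((F ε).NLM : ℝ)) (𝓝[>] 0) (𝓝 (ρ * (r₀ - l₀))) := by
  have h1 : Tendsto (fun ε : ℝ => ε) (𝓝[>] 0) (𝓝 0) := nhdsWithin_le_nhds
  have h2 := hρ.mul ((hs.right.sub hs.left).add h1)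
  rw [add_zero] at h2
  refine h2.congr fun ε => ?_
  have h3 : ((F ε).Ncols : ℝ) = (F ε).r - (F ε).l + 1 := by
    simp [WeightedGraph.Ncols]
  have h4 : (0 : ℝ) < (F ε).Ncols := by
    have := (F ε).l_lt_r
    have : 0 < (F ε).Ncols := by
      unfold WeightedGraph.Ncols
      omega
    exact_mod_cast this
  rw [show ε * ((F ε).r : ℝ) - ε * (F ε).l + ε = (F ε).Ncols * ε by rw [h3]; ring, ← mul_assoc,
    div_mul_cancel₀ _ h4.ne', mul_comm]

theorem WeightSeparation.eventually_log_div {F : ℝ → Model} {α β : ℝ} (h : WeightSeparation F α)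
    (hβ : β < α) :
    ∀ᶠ ε in 𝓝[>] (0 : ℝ), ∀ i ∈ (F ε).colsLM, ∀ j ∈ (F ε).colsLM, (F ε).x j < (F ε).x i →
      β / ε ≤ Real.log ((F ε).x i / (F ε).x j) := by
  have h1 : (β : EReal) < α := EReal.coe_lt_coe_iff.2 hβ
  filter_upwards [eventually_lt_of_lt_liminf (h1.trans_le h.separated), self_mem_nhdsWithin]
    with ε hε hpos i hi j hj hij
  have hpos' : (0 : ℝ) < ε := hpos
  have h2 := hε.trans_le (iInf₂_le (i, j)
    (Finset.mem_filter.2 ⟨Finset.mem_product.2 ⟨hi, hj⟩, hij⟩))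
  rw [EReal.coe_lt_coe_iff] at h2
  rw [div_le_iff₀' hpos']
  exact h2.le

/-- Consecutive parts belong to adjacent blocks, so their difference is the number of empty sites
between the blocks. -/
theorem Model.block_gap (M : Model) {s : ℕ} (μ K : Fin s → ℕ) {p q : Fin s}
    (hpq : p.val + 1 = q.val) :
    (μ p : ℤ) - μ q = M.blockBottom μ K p.rev - M.blockTop μ K q.rev - 1 := by
  have h1 : Finset.Iio p.rev = insert q.rev (Finset.Iio q.rev) := by
    ext u
    simp only [Finset.mem_Iio, Finset.mem_insert, Fin.lt_def, Fin.ext_iff, Fin.val_rev]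
    omega
  rw [Model.blockTop, Model.blockBottom, Model.blockBottom, h1,
    Finset.sum_insert (by simp), Fin.rev_rev, Fin.rev_rev]
  ring

/-- Gives a part gap governed by `a` and `b` alone, unlike the family-dependent `C₁`. Of `γ * N`,
two errors `γ / 8 * N` and the off-by-one `1 ≤ γ / 4 * N` take at most half. -/
theorem BoundaryLimit.eventually_gap {F : ℝ → Model} {s : ℕ} {μ K : ℝ → Fin s → ℕ}
    {a b : Fin s → ℝ} (h : BoundaryLimit F μ K a b) {γ : ℝ} (hγ : 0 < γ)
    (hab : ∀ i j, i < j → γ ≤ a j - b i) (hanti : ∀ᶠ ε in 𝓝[>] (0 : ℝ), Antitone (μ ε))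
    (hN : Tendsto (fun ε => ((F ε).NLM : ℝ)) (𝓝[>] 0) atTop) :
    ∀ᶠ ε in 𝓝[>] (0 : ℝ), ∀ p q : Fin s, p < q →
      γ / 2 * ((F ε).NLM : ℝ) ≤ (μ ε p : ℝ) - μ ε q := by
  have hγ8 : 0 < γ / 8 := by positivity
  filter_upwards [eventually_all.2 fun i => (h.bottom i).bound hγ8,
    eventually_all.2 fun i => (h.top i).bound hγ8, hanti,
    hN.eventually_ge_atTop (4 / γ)] with ε h1 h2 h3 h4 p q hpq
  obtain ⟨p', hp'⟩ : ∃ p' : Fin s, p.val + 1 = p'.val := ⟨⟨p.val + 1, by omega⟩, rfl⟩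
  have h5 : (μ ε q : ℝ) ≤ μ ε p' := by
    have : p' ≤ q := by
      rw [Fin.le_def]
      omega
    exact_mod_cast h3 this
  have h6 := (F ε).block_gap (μ ε) (K ε) hp'
  have h6' : (μ ε p : ℝ) - μ ε p' = (F ε).blockBottom (μ ε) (K ε) p.rev -
      (F ε).blockTop (μ ε) (K ε) p'.rev - 1 := by exact_mod_cast h6
  have h7 := h1 p.rev
  have h8 := h2 p'.rev
  rw [Real.norm_eq_abs, Real.norm_natCast, abs_le] at h7 h8
  have h9 := hab p'.rev p.rev (by rw [Fin.rev_lt_rev, Fin.lt_def]; omega)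
  have h10 := mul_le_mul_of_nonneg_right h9 (Nat.cast_nonneg (α := ℝ) (F ε).NLM)
  rw [div_le_iff₀ hγ] at h4
  linarith [h7.1, h8.2]

/-- Write `log (c * ν) = log (c * (ε * ν)) - log ε`: the first term converges, and `ε * log ε → 0`.
-/
theorem tendsto_mul_log_const_mul {ν : ℝ → ℝ} {κ c : ℝ} (hκ : 0 < κ) (hc : 0 < c)
    (hν : Tendsto (fun ε => ε * ν ε) (𝓝[>] 0) (𝓝 κ)) :
    Tendsto (fun ε => ε * Real.log (c * ν ε)) (𝓝[>] 0) (𝓝 0) := by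
  have h1 : Tendsto (fun ε : ℝ => ε) (𝓝[>] 0) (𝓝 0) := nhdsWithin_le_nhds
  have h2 : Tendsto (fun ε => Real.log (c * (ε * ν ε))) (𝓝[>] 0) (𝓝 (Real.log (c * κ))) :=
    (hν.const_mul c).log (by positivity)
  have h4 : Tendsto (fun ε : ℝ => ε * Real.log ε) (𝓝[>] 0) (𝓝 0) :=
    (Real.continuous_mul_log.tendsto' 0 0 (by simp)).mono_left nhdsWithin_le_nhds
  have h3 := (h1.mul h2).sub h4
  rw [zero_mul, sub_zero] at h3
  refine h3.congr' ?_
  filter_upwards [self_mem_nhdsWithin, hν.eventually_const_lt hκ] with ε hε hpos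
  have hε' : (0 : ℝ) < ε := hε
  have hν' : 0 < ν ε := pos_of_mul_pos_right hpos hε'.le
  rw [Real.log_mul hc.ne' hpos.ne', Real.log_mul hε'.ne' hν'.ne', Real.log_mul hc.ne' hν'.ne']
  ring

end RailYard

theorem proposition3p1 {s : ℕ} (a b : Fin s → ℝ)
    (hab : ∀ i, a i < b i) (hba : ∀ i j, i < j → b i < a j) (hsum : ∑ i, (b i - a i) = 1) :
    ∃ α₀ : ℝ, 0 < α₀ ∧ ∀ l₀ r₀ ρ : ℝ, l₀ < r₀ → ρ ∈ Set.Ioc (0 : ℝ) 1 →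
      ∃ C : ℝ → ℝ, (∀ α, α₀ ≤ α → 0 < C α) ∧ StrictMonoOn C (Set.Ici α₀) ∧
        Tendsto C atTop atTop ∧
        ∀ (α : ℝ), α₀ ≤ α →
        ∀ (F : ℝ → RailYard.Model) (n : ℕ) (θ : Fin n → ℝ) (μ K : ℝ → Fin s → ℕ),
          RailYard.ScalingLimit F l₀ r₀ →
          RailYard.PiecewiseBoundary F n μ K →
          RailYard.BoundaryLimit F μ K a b →
          RailYard.WeightSeparation F α →
          RailYard.Proportions F θ ρ →
          ∀ᶠ ε in 𝓝[>] (0 : ℝ), ∀ σ : (F ε).Bij, σ ∉ (F ε).coset (F ε).sigma0 →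
            Real.exp (C α * ε ^ (-2 : ℤ)) ≤
              |(F ε).schurFactor (F ε).sigma0 / (F ε).schurFactor σ| *
                |(F ε).pairFactor (F ε).sigma0 / (F ε).pairFactor σ| := by
  obtain ⟨γ, hγ, hγab⟩ := RailYard.exists_pos_gap a b hba
  -- Any positive `α₀` would do, since the loss is `o(ε⁻²)`.
  refine ⟨1, one_pos, fun l₀ r₀ ρ hlr hρ => ?_⟩
  set κ := ρ * (r₀ - l₀) with hκdef
  have hκ : 0 < κ := mul_pos hρ.1 (sub_pos.2 hlr)
  have hc : 0 < γ * κ / 32 := by positivity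
  refine ⟨fun α => γ * κ / 32 * α, fun α hα => mul_pos hc (by linarith),
    fun α _ β _ h => mul_lt_mul_of_pos_left h hc, tendsto_id.const_mul_atTop hc, ?_⟩
  intro α hα F n θ μ K hscale hpb hbl hws hprop
  have hα0 : 0 < α := by linarith
  have hν := RailYard.tendsto_mul_NLM hscale hprop.rho_lim
  rw [← hκdef] at hν
  have hνtop : Tendsto (fun ε => ((F ε).NLM : ℝ)) (𝓝[>] 0) atTop := by
    refine ((hν.pos_mul_atTop hκ tendsto_inv_nhdsGT_zero)).congr' ?_
    filter_upwards [self_mem_nhdsWithin] with ε hε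
    have hε' : (0 : ℝ) < ε := hε
    field_simp
  -- `C` may not depend on the family; `C₂` enters only inside a logarithm, and so affects only how
  -- small `ε` must be.
  obtain ⟨_, C₂, _, hC₂, hgaps⟩ := hpb.gaps
  have hanti : ∀ᶠ ε in 𝓝[>] (0 : ℝ), Antitone (μ ε) :=
    hpb.blocks.mono fun ε h => h.mu_anti.antitone
  have hloss := (hν.mul (RailYard.tendsto_mul_log_const_mul hκ
    (show 0 < C₂ + 1 by positivity) hν)).const_mul 2
  rw [mul_zero, mul_zero] at hloss
  filter_upwards [self_mem_nhdsWithin, hpb.numWeights_eq, hpb.blocks, hpb.J_lt, hgaps,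
    hbl.eventually_gap hγ hγab hanti hνtop, hws.eventually_log_div (half_lt_self hα0),
    hνtop.eventually_ge_atTop 1, hν.eventually_const_lt (half_lt_self hκ),
    hloss.eventually_lt_const (show 0 < γ * κ / 32 * α by positivity)]
    with ε hε hn hblocks hJ hgap hG hg hν1 hνκ hls σ hσ
  have hε' : (0 : ℝ) < ε := hε
  set ν : ℝ := ((F ε).NLM : ℝ) with hνdef
  -- With log gap `α / (2ε)`, part gap `γ * ν / 2` and `ε * ν > κ / 2`, the gain is at least `γ * κ
  -- * α / 16 * ε⁻²`; the loss takes at most half of it.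
  have hbound : γ * κ / 32 * α * ε ^ (-2 : ℤ) ≤
      α / 2 / ε * (γ / 2 * ν) / 2 - 2 * ν * Real.log ((C₂ + 1) * ν) := by
    rw [zpow_neg, ← div_eq_mul_inv, zpow_ofNat, div_le_iff₀ (by positivity)]
    have h1 : (α / 2 / ε * (γ / 2 * ν) / 2 - 2 * ν * Real.log ((C₂ + 1) * ν)) * ε ^ 2 =
        α * γ / 8 * (ε * ν) - 2 * (ε * ν * (ε * Real.log ((C₂ + 1) * ν))) := by
      field_simp
      ring
    have h2 := mul_le_mul_of_nonneg_left hνκ.le (show 0 ≤ α * γ / 8 by positivity)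
    rw [h1]
    linarith
  have hC₂ν : 0 ≤ C₂ * ν := by positivity
  refine le_trans (Real.exp_le_exp.2 hbound) ?_
  refine (F ε).exp_le_ratio hblocks (by rw [hn]; exact hJ) (by positivity) (by positivity) hg hG
    (fun p q h => ?_) ?_ ?_ (le_trans (by positivity) hbound) σ hσ
  · linarith [(hgap p q h).2]
  · linarith
  · linarith
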